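/- Let $\mathcal A$ be a Grothendieck category. A nonzero object $M$ of an abelian category is called monoform if, for every nonzero subobject $N\subseteq M$, no nonzero subobject of $M$ is isomorphic to a subobject of $M/N$. Two monoform objects are atom-equivalent if they have a common nonzero subobject up to isomorphism, and the atom spectrum $\mathrm{ASpec}$ of the category is the collection of equivalence classes $\overline H$ (atoms) of monoform objects $H$. The atom support $\mathrm{ASupp}\, M$ of an object $M$ is the set of atoms $\overline H$ with $H$ a monoform subquotient of $M$. A subset $\Phi$ of the atom spectrum is open if every $\alpha\in\Phi$ can be written as $\alpha=\overline H$ with $H$ monoform and $\mathrm{ASupp}\, H\subseteq\Phi$; this defines a topology. A topological space is Alexandroff if every intersection of open subsets is open. Let $\mathcal X$ be a localizing subcategory of $\mathcal A$, that is, a Serre subcategory such that the canonical functor $\mathcal A\to\mathcal A/\mathcal X$ to the quotient category has a right adjoint. If $\mathrm{ASpec}\,\mathcal A$ is Alexandroff, then $\mathrm{ASpec}(\mathcal A/\mathcal X)$ is Alexandroff. -/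

import Mathlib

open CategoryTheory CategoryTheory.Limits

universe w v u

namespace AtomSpec

section Atoms

variable {C : Type u} [Category.{v} C] [Abelian C]

/-- Some nonzero object is (isomorphic to) a subobject of both `X` and `Y`. -/
def HasCommonNonzeroSubobject (X Y : C) : Prop :=
  ∃ (D : C) (i : D ⟶ X) (j : D ⟶ Y), ¬ IsZero D ∧ Mono i ∧ Mono j

/-- A nonzero object `M` is monoform if for each nonzero subobject `i : N ⟶ M` there is no
common nonzero subobject of `M` and `M / N`. -/
def IsMonoform (M : C) : Prop :=
  ¬ IsZero M ∧ ∀ (N : C) (i : N ⟶ M) [Mono i], ¬ IsZero N →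
    ¬ HasCommonNonzeroSubobject M (cokernel i)

/-- `H` is a subquotient of `M`: a quotient object of a subobject of `M`. -/
def IsSubquotient (H M : C) : Prop :=
  ∃ (N : C) (i : N ⟶ M) (p : N ⟶ H), Mono i ∧ Epi p

lemma HasCommonNonzeroSubobject.symm {X Y : C} (h : HasCommonNonzeroSubobject X Y) :
    HasCommonNonzeroSubobject Y X := by
  obtain ⟨D, i, j, h0, hi, hj⟩ := h
  exact ⟨D, j, i, h0, hj, hi⟩

/-- Two nonzero subobjects of a monoform object intersect in a nonzero object. -/
lemma IsMonoform.pullback_not_isZero {M D E : C} (hM : IsMonoform M) (i : D ⟶ M) (j : E ⟶ M)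
    [Mono i] [Mono j] (hD : ¬ IsZero D) (hE : ¬ IsZero E) : ¬ IsZero (pullback i j) := by
  intro h0
  refine hM.2 E j hE ⟨D, i, i ≫ cokernel.π j, hD, inferInstance, ?_⟩
  rw [Preadditive.mono_iff_cancel_zero]
  intro T f hf
  have hf' : (f ≫ i) ≫ cokernel.π j = 0 := by simpa using hf
  have h1 : f ≫ i = Abelian.monoLift j (f ≫ i) hf' ≫ j :=
    (Abelian.monoLift_comp j (f ≫ i) hf').symm
  rw [← pullback.lift_fst f _ h1, h0.eq_of_src (pullback.fst i j) 0, comp_zero]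

lemma IsMonoform.of_mono {M D : C} (hM : IsMonoform M) (i : D ⟶ M) [Mono i]
    (hD : ¬ IsZero D) : IsMonoform D := by
  refine ⟨hD, fun N k _ hN hc => ?_⟩
  obtain ⟨E, a, b, hE, ha, hb⟩ := hc
  let q : cokernel k ⟶ cokernel (k ≫ i) := cokernel.map k (k ≫ i) (𝟙 N) i (by simp)
  have hq : Mono q := by
    rw [Preadditive.mono_iff_cancel_zero]
    intro T f hf
    obtain ⟨T', π, hπ, g, hg⟩ := surjective_up_to_refinements_of_epi (cokernel.π k) f
    have h1 : (g ≫ i) ≫ cokernel.π (k ≫ i) = 0 := by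
      have h2 : cokernel.π k ≫ q = i ≫ cokernel.π (k ≫ i) := by simp [q]
      rw [Category.assoc, ← h2, ← Category.assoc, ← hg, Category.assoc, hf, comp_zero]
    have h3 : Abelian.monoLift (k ≫ i) (g ≫ i) h1 ≫ k = g := by
      rw [← cancel_mono i, Category.assoc, Abelian.monoLift_comp]
    rw [← cancel_epi π, hg, ← h3]
    simp
  exact hM.2 N (k ≫ i) hN ⟨E, a ≫ i, b ≫ q, hE, inferInstance, inferInstance⟩

lemma IsSubquotient.trans_mono {H D M : C} (h : IsSubquotient H D) (i : D ⟶ M) [Mono i] :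
    IsSubquotient H M := by
  obtain ⟨N, k, p, hk, hp⟩ := h
  exact ⟨N, k ≫ i, p, inferInstance, hp⟩

variable (C) in
/-- The monoform objects of `C`. -/
def MonoformObject : Type u := {M : C // IsMonoform M}

variable (C) in
/-- Atom equivalence: having a common nonzero subobject. -/
def atomSetoid : Setoid (MonoformObject C) where
  r H H' := HasCommonNonzeroSubobject H.1 H'.1
  iseqv :=
    { refl := fun H => ⟨H.1, 𝟙 _, 𝟙 _, H.2.1, inferInstance, inferInstance⟩
      symm := fun h => h.symm
      trans := by
        rintro H₁ H₂ H₃ ⟨D, i, j, hD, hi, hj⟩ ⟨E, k, l, hE, hk, hl⟩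
        exact ⟨pullback j k, pullback.fst j k ≫ i, pullback.snd j k ≫ l,
          H₂.2.pullback_not_isZero j k hD hE, inferInstance, inferInstance⟩ }

variable (C) in
/-- The atom spectrum of `C`: monoform objects up to atom equivalence. -/
def ASpec : Type u := Quotient (atomSetoid C)

/-- The atom of a monoform object. -/
def atom (H : C) (hH : IsMonoform H) : ASpec C := Quotient.mk (atomSetoid C) ⟨H, hH⟩

/-- The atom support of `M`: the atoms represented by some monoform subquotient of `M`. -/
def ASupp (M : C) : Set (ASpec C) :=
  {α | ∃ (H : C) (hH : IsMonoform H), α = atom H hH ∧ IsSubquotient H M}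

lemma ASupp_subset_of_mono {D M : C} (i : D ⟶ M) [Mono i] : ASupp D ⊆ ASupp M := by
  rintro _ ⟨H, hH, rfl, h⟩
  exact ⟨H, hH, rfl, h.trans_mono i⟩

/-- The topology of the atom spectrum: `Φ` is open iff each atom in `Φ` is represented by a
monoform object whose atom support lies in `Φ`. -/
instance : TopologicalSpace (ASpec C) where
  IsOpen Φ := ∀ α ∈ Φ, ∃ (H : C) (hH : IsMonoform H), α = atom H hH ∧ ASupp H ⊆ Φ
  isOpen_univ := by
    intro α _
    obtain ⟨⟨H, hH⟩, rfl⟩ := Quotient.exists_rep α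
    exact ⟨H, hH, rfl, Set.subset_univ _⟩
  isOpen_inter := by
    rintro Φ Ψ h₁ h₂ α ⟨hα₁, hα₂⟩
    obtain ⟨H₁, hH₁, rfl, hs₁⟩ := h₁ α hα₁
    obtain ⟨H₂, hH₂, he, hs₂⟩ := h₂ _ hα₂
    obtain ⟨D, i, j, hD, hi, hj⟩ : HasCommonNonzeroSubobject H₁ H₂ := Quotient.exact he
    refine ⟨D, hH₁.of_mono i hD, ?_, Set.subset_inter ((ASupp_subset_of_mono i).trans hs₁)
      ((ASupp_subset_of_mono j).trans hs₂)⟩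
    exact Quotient.sound ⟨D, i, 𝟙 D, hD, hi, inferInstance⟩
  isOpen_sUnion := by
    rintro S hS α ⟨Φ, hΦ, hα⟩
    obtain ⟨H, hH, he, hs⟩ := hS Φ hΦ α hα
    exact ⟨H, hH, he, hs.trans (Set.subset_sUnion_of_mem hΦ)⟩

end Atoms

section Quotients

variable {C : Type u} [Category.{v} C] [Abelian C] (X : ObjectProperty C) [X.IsSerreClass]

/-- The quotient category `C / X` by a Serre subcategory `X`: the localization of `C` at the
morphisms whose kernel and cokernel lie in `X`. -/
abbrev QuotientCategory : Type u := X.isoModSerre.Localization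

/-- The canonical functor `C ⥤ C / X`. -/
noncomputable abbrev quotientFunctor : C ⥤ QuotientCategory X := X.isoModSerre.Q

noncomputable instance : Abelian (QuotientCategory X) :=
  ObjectProperty.SerreClassLocalization.abelian (quotientFunctor X) X

/-- A Serre subcategory is localizing if the canonical functor to the quotient category has a
right adjoint. -/
class IsLocalizing : Prop where
  isLeftAdjoint : (quotientFunctor X).IsLeftAdjoint

end Quotients

end AtomSpec

namespace AtomSpec

section Subquotients

/-! Let `L : A ⥤ A/X` be the canonical functor and `G` its right adjoint. `L` is exact, and the
counit `LG ⟶ 𝟭` is invertible because `L` is a localization. Objects `G.obj H` have no nonzero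
subobject killed by `L`, so `G` preserves monoform objects and induces a map `atomMap` of atom
spectra. Supports are compatible with this map in both directions (`atomMap_mem_ASupp`,
`mem_ASupp_of_atomMap_mem`), hence the topology on the spectrum of `A/X` is the induced one
(`isInducing_atomMap`). The Alexandroff property passes along inducing maps. -/

lemma IsSubquotient.of_mono {C : Type*} [Category* C] {D M : C} (i : D ⟶ M)
    [Mono i] : IsSubquotient D M :=
  ⟨D, i, 𝟙 D, inferInstance, inferInstance⟩

lemma IsSubquotient.map {C D : Type*} [Category* C] [Category* D] (L : C ⥤ D)
    [L.PreservesMonomorphisms] [L.PreservesEpimorphisms] {K M : C} (h : IsSubquotient K M) :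
    IsSubquotient (L.obj K) (L.obj M) := by
  obtain ⟨N, i, p, _, _⟩ := h
  exact ⟨L.obj N, L.map i, L.map p, inferInstance, inferInstance⟩

variable {C : Type*} [Category* C] [Abelian C]

lemma IsSubquotient.trans {K H M : C} (h : IsSubquotient K H) (h' : IsSubquotient H M) :
    IsSubquotient K M := by
  obtain ⟨N, i, p, _, _⟩ := h
  obtain ⟨N', i', p', _, _⟩ := h'
  exact ⟨pullback p' i, pullback.fst p' i ≫ i', pullback.snd p' i ≫ p, inferInstance,
    inferInstance⟩

lemma atom_eq_iff {H K : C} (hH : IsMonoform H) (hK : IsMonoform K) :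
    atom H hH = atom K hK ↔ HasCommonNonzeroSubobject H K :=
  Quotient.eq (r := atomSetoid C)

lemma atom_eq_of_mono {H K : C} (hH : IsMonoform H) (hK : IsMonoform K) (i : H ⟶ K) [Mono i] :
    atom H hH = atom K hK :=
  (atom_eq_iff hH hK).2 ⟨H, 𝟙 H, i, hH.1, inferInstance, inferInstance⟩

lemma isOpen_iff {Φ : Set (ASpec C)} :
    IsOpen Φ ↔ ∀ α ∈ Φ, ∃ (H : C) (hH : IsMonoform H), α = atom H hH ∧ ASupp H ⊆ Φ :=
  Iff.rfl

lemma ASupp_subset_of_isSubquotient {H M : C} (h : IsSubquotient H M) : ASupp H ⊆ ASupp M := by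
  rintro _ ⟨K, hK, rfl, hKH⟩
  exact ⟨K, hK, rfl, hKH.trans h⟩

lemma isOpen_ASupp (M : C) : IsOpen (ASupp M) := by
  rintro _ ⟨H, hH, rfl, hHM⟩
  exact ⟨H, hH, rfl, ASupp_subset_of_isSubquotient hHM⟩

end Subquotients

section Reflection

/-- The adjunct of `i` starts at a zero object, so `i` is both zero and mono. Consequently `L` keeps
nonzero subobjects of `G.obj H` nonzero. -/
lemma isZero_of_mono_rightAdjoint {C D : Type*} [Category* C] [Category* D] [Abelian C]
    {L : C ⥤ D} {G : D ⥤ C} (adj : L ⊣ G) {N : C} {H : D} (i : N ⟶ G.obj H) [Mono i]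
    (hN : IsZero (L.obj N)) : IsZero N := by
  rw [IsZero.iff_id_eq_zero, ← cancel_mono i]
  exact (adj.homEquiv _ _).symm.injective (hN.eq_of_src _ _)

variable {C D : Type*} [Category* C] [Category* D] [Abelian C] [Abelian D]
  {L : C ⥤ D} {G : D ⥤ C}

lemma not_isZero_rightAdjoint_obj (adj : L ⊣ G) [IsIso adj.counit] [L.Additive] {H : D}
    (hH : ¬ IsZero H) : ¬ IsZero (G.obj H) := fun h =>
  hH ((L.map_isZero h).of_iso (asIso (adj.counit.app H)).symm)

lemma HasCommonNonzeroSubobject.map_rightAdjoint (adj : L ⊣ G) [IsIso adj.counit] [L.Additive]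
    {H K : D} (h : HasCommonNonzeroSubobject H K) :
    HasCommonNonzeroSubobject (G.obj H) (G.obj K) := by
  obtain ⟨E, i, j, hE, _, _⟩ := h
  have := adj.rightAdjoint_preservesLimits
  exact ⟨G.obj E, G.map i, G.map j, not_isZero_rightAdjoint_obj adj hE, inferInstance,
    inferInstance⟩

/-- The exact functor `L` turns a forbidden common subobject of `G.obj H` and its quotient by `N`
into one of `H` and its quotient by `L.obj N`. -/
lemma IsMonoform.rightAdjoint_obj (adj : L ⊣ G) [IsIso adj.counit] [L.Additive]
    [L.PreservesMonomorphisms] {H : D} (hH : IsMonoform H) : IsMonoform (G.obj H) := by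
  refine ⟨not_isZero_rightAdjoint_obj adj hH.1, ?_⟩
  rintro N i _ hN ⟨E, a, b, hE, _, _⟩
  have := adj.leftAdjoint_preservesColimits
  let e : L.obj (cokernel i) ≅ cokernel (L.map i ≫ adj.counit.app H) :=
    PreservesCokernel.iso L i ≪≫
      cokernel.mapIso _ _ (Iso.refl _) (asIso (adj.counit.app H)) (by simp)
  exact hH.2 (L.obj N) (L.map i ≫ adj.counit.app H)
    (fun h => hN (isZero_of_mono_rightAdjoint adj i h))
    ⟨L.obj E, L.map a ≫ adj.counit.app H, L.map b ≫ e.hom,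
      fun h => hE (isZero_of_mono_rightAdjoint adj a h), inferInstance, inferInstance⟩

/-- The map of atom spectra induced by the right adjoint of an exact reflection functor. -/
def atomMap (adj : L ⊣ G) [IsIso adj.counit] [L.Additive] [L.PreservesMonomorphisms] :
    ASpec D → ASpec C :=
  Quotient.map' (s₁ := atomSetoid D) (s₂ := atomSetoid C)
    (fun H => ⟨G.obj H.1, H.2.rightAdjoint_obj adj⟩)
    (fun _ _ h => HasCommonNonzeroSubobject.map_rightAdjoint adj h)

lemma atomMap_atom (adj : L ⊣ G) [IsIso adj.counit] [L.Additive] [L.PreservesMonomorphisms]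
    (H : D) (hH : IsMonoform H) :
    atomMap adj (atom H hH) = atom (G.obj H) (hH.rightAdjoint_obj adj) := rfl

lemma ASpec.exists_eq_atom (α : ASpec D) : ∃ (H : D) (hH : IsMonoform H), α = atom H hH := by
  obtain ⟨⟨H, hH⟩, rfl⟩ := Quotient.exists_rep α
  exact ⟨H, hH, rfl⟩

/-- Atoms supported on `L.obj M` come from atoms supported on `M`. -/
lemma atomMap_mem_ASupp (adj : L ⊣ G) [IsIso adj.counit] [L.Additive]
    [PreservesFiniteLimits L] {M : C} {α : ASpec D} (hα : α ∈ ASupp (L.obj M)) :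
    atomMap adj α ∈ ASupp M := by
  obtain ⟨K, hK, rfl, N, i, p, _, _⟩ := hα
  have := adj.rightAdjoint_preservesLimits
  have := adj.leftAdjoint_preservesColimits
  -- The pullback is the preimage of `G.obj N` under the unit. `G` is only left exact, so `q` need
  -- not be epi; but `L.map q` is, since `L` inverts the unit and `LG ≅ 𝟭`. The image of `q` then
  -- serves as the monoform subquotient of `M`.
  let q : pullback (adj.unit.app M) (G.map i) ⟶ G.obj K := pullback.snd _ _ ≫ G.map p
  have hq : Epi (L.map q) := by
    have h₁ : IsIso (L.map (adj.unit.app M)) :=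
      isIso_of_comp_hom_eq_id (adj.counit.app (L.obj M)) (adj.left_triangle_components M)
    have h₂ : IsIso (L.map (pullback.snd (adj.unit.app M) (G.map i))) :=
      ((IsPullback.of_hasPullback (adj.unit.app M) (G.map i)).map L).isIso_snd_of_isIso
    have h₃ : Epi (L.map (G.map p)) := by
      have h := adj.counit.naturality p
      simp only [Functor.comp_map, Functor.id_map] at h
      rw [← IsIso.eq_comp_inv] at h
      rw [h]
      infer_instance
    simp only [q, Functor.map_comp]
    infer_instance
  have hI : ¬ IsZero (image q) := fun h => hK.1 <| by
    have hz : q = 0 := by rw [← image.fac q, h.eq_of_src (image.ι q) 0, comp_zero]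
    exact (IsZero.of_epi_eq_zero (L.map q) (by rw [hz, L.map_zero])).of_iso
      (asIso (adj.counit.app K)).symm
  refine ⟨image q, (hK.rightAdjoint_obj adj).of_mono (image.ι q) hI, ?_,
    _, pullback.fst _ _, factorThruImage q, inferInstance, inferInstance⟩
  exact (atom_eq_of_mono _ _ (image.ι q)).symm

/-- Conversely, an atom in the support of `G.obj H` that comes from `D` is supported on `H`. -/
lemma mem_ASupp_of_atomMap_mem (adj : L ⊣ G) [IsIso adj.counit] [L.Additive]
    [L.PreservesMonomorphisms] {H : D} {α : ASpec D} (hα : atomMap adj α ∈ ASupp (G.obj H)) :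
    α ∈ ASupp H := by
  obtain ⟨K, hK, rfl⟩ := ASpec.exists_eq_atom α
  obtain ⟨J, hJ, he, hJH⟩ := hα
  rw [atomMap_atom, atom_eq_iff] at he
  obtain ⟨E, i, j, hE, _, _⟩ := he
  have := adj.leftAdjoint_preservesColimits
  have hE' : ¬ IsZero (L.obj E) := fun h => hE (isZero_of_mono_rightAdjoint adj i h)
  -- `L.obj E` embeds in `LG K ≅ K`, so it represents the same atom, and it is a subquotient of `LG
  -- H ≅ H`.
  refine ⟨L.obj E, hK.of_mono (L.map i ≫ adj.counit.app K) hE',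
    (atom_eq_of_mono _ _ (L.map i ≫ adj.counit.app K)).symm, ?_⟩
  exact (((IsSubquotient.of_mono j).trans hJH).map L).trans
    (IsSubquotient.of_mono (adj.counit.app H))

lemma isInducing_atomMap (adj : L ⊣ G) [IsIso adj.counit] [L.Additive]
    [PreservesFiniteLimits L] : Topology.IsInducing (atomMap adj) := by
  refine ⟨TopologicalSpace.ext (funext fun Ψ => propext ?_)⟩
  refine Iff.trans ?_ isOpen_induced_iff.symm
  constructor
  · intro hΨ
    -- `Ψ` is the union of the supports it contains; replacing each `ASupp H` by the open set `ASupp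
    -- (G.obj H)` gives an open set with preimage `Ψ`.
    refine ⟨⋃ H ∈ {H : D | ASupp H ⊆ Ψ}, ASupp (G.obj H),
      isOpen_biUnion fun H _ => isOpen_ASupp _, Set.Subset.antisymm ?_ ?_⟩
    · intro α hα
      obtain ⟨H, hH, h⟩ := Set.mem_iUnion₂.1 hα
      exact hH (mem_ASupp_of_atomMap_mem adj h)
    · intro α hα
      obtain ⟨H, hH, rfl, hs⟩ := isOpen_iff.1 hΨ α hα
      exact Set.mem_iUnion₂.2 ⟨H, hs, G.obj H, hH.rightAdjoint_obj adj, rfl,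
        IsSubquotient.of_mono (𝟙 _)⟩
  · rintro ⟨Φ, hΦ, rfl⟩
    refine isOpen_iff.2 fun α hα => ?_
    obtain ⟨K, hK, rfl⟩ := ASpec.exists_eq_atom α
    obtain ⟨H, hH, he, hs⟩ := isOpen_iff.1 hΦ _ hα
    rw [atomMap_atom, atom_eq_iff] at he
    obtain ⟨E, i, j, hE, _, _⟩ := he
    have hE' : ¬ IsZero (L.obj E) := fun h => hE (isZero_of_mono_rightAdjoint adj i h)
    -- The atom of `K` is represented by `L.obj E`, whose support is sent into `ASupp E`, hence into
    -- `ASupp H ⊆ Φ`.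
    refine ⟨L.obj E, hK.of_mono (L.map i ≫ adj.counit.app K) hE',
      (atom_eq_of_mono _ _ (L.map i ≫ adj.counit.app K)).symm, fun β hβ => hs ?_⟩
    exact ASupp_subset_of_mono j (atomMap_mem_ASupp adj hβ)

end Reflection

/-- The right adjoint of a localization functor is fully faithful: the counit is invertible. -/
lemma isIso_counit_of_isLocalization {C D : Type*} [Category* C] [Category* D] {L : C ⥤ D}
    {G : D ⥤ C} (adj : L ⊣ G) (W : MorphismProperty C) [L.IsLocalization W] :
    IsIso adj.counit := by
  have := Localization.full_whiskeringLeft L W D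
  have := Localization.faithful_whiskeringLeft L W D
  -- Precomposition with `L` is fully faithful and right adjoint to precomposition with `G`, so that
  -- counit is invertible; at `𝟭 D` its components are those of `adj.counit`.
  have h (X : D) : IsIso (((adj.whiskerLeft D).counit.app (𝟭 D)).app X) := inferInstance
  simp only [Adjunction.whiskerLeft_counit_app_app, Functor.id_map] at h
  exact NatIso.isIso_of_isIso_app _

end AtomSpec

theorem mainTheorem9 {A : Type u} [Category.{v} A] [Abelian A] [IsGrothendieckAbelian.{w} A]
    (X : ObjectProperty A) [X.IsSerreClass] [AtomSpec.IsLocalizing X]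
    (hA : AlexandrovDiscrete (AtomSpec.ASpec A)) :
    AlexandrovDiscrete (AtomSpec.ASpec (AtomSpec.QuotientCategory X)) := by
  have := AtomSpec.IsLocalizing.isLeftAdjoint (X := X)
  have adj := Adjunction.ofIsLeftAdjoint (AtomSpec.quotientFunctor X)
  have := AtomSpec.isIso_counit_of_isLocalization adj X.isoModSerre
  have : PreservesFiniteLimits (AtomSpec.quotientFunctor X) :=
    ObjectProperty.SerreClassLocalization.preservesFiniteLimits _ X
  exact (AtomSpec.isInducing_atomMap adj).alexandrovDiscrete
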